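/- Let $d$ be a natural number, let $B_r$ denote the open ball of radius $r$ centered at the origin of the Euclidean space $\mathbb{R}^d$, and let $\Delta_\infty\varphi=\sum_{i,j=1}^d \partial_i\varphi\,\partial_j\varphi\,\partial_{ij}\varphi$. A function $u\colon B_1\to\mathbb{R}$ is called infinity-harmonic if it is continuous and a viscosity solution of $\Delta_\infty u=0$ in $B_1$, i.e. for every $\varphi\in C^\infty(\mathbb{R}^d)$ and every $Z\in B_1$: $\Delta_\infty\varphi(Z)\ge 0$ whenever $u-\varphi$ has a local maximum at $Z$, and $\Delta_\infty\varphi(Z)\le 0$ whenever $u-\varphi$ has a local minimum at $Z$. Let $u\colon B_1\to\mathbb{R}$ be infinity-harmonic, and assume that there are continuous functions $\sigma_1,\dots,\sigma_d\colon(-1,1)\to\mathbb{R}$ such that $$u(X)=\sigma_1(x_1)+\sigma_2(x_2)+\cdots+\sigma_d(x_d)\qquad\text{for all } X=(x_1,\dots,x_d)\in B_1.$$ Then $u\in C^{1,\frac13}(B_{1/2})$; that is, $u$ is continuously differentiable in $B_{1/2}$, $u$ and $\nabla u$ are bounded in $B_{1/2}$, and there is a constant $C$ (which may depend on $u$) with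 $|\nabla u(X)-\nabla u(Y)|\le C\,|X-Y|^{1/3}$ for all $X,Y\in B_{1/2}$. -/

import Mathlib

open scoped NNReal ContDiff Topology

/-- The partial derivative `∂ᵢ φ` at the point `X` of `ℝᵈ`. -/
noncomputable def partialD {d : ℕ} (i : Fin d) (φ : EuclideanSpace ℝ (Fin d) → ℝ)
    (X : EuclideanSpace ℝ (Fin d)) : ℝ :=
  fderiv ℝ φ X (EuclideanSpace.single i (1 : ℝ))

/-- The infinity-Laplacian `Δ_∞ φ = ∑_{i,j} ∂ᵢφ ∂ⱼφ ∂ᵢⱼφ`, where `∂ᵢⱼφ = ∂ᵢ(∂ⱼφ)`.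
It is only applied to smooth functions. -/
noncomputable def infinityLaplacian {d : ℕ} (φ : EuclideanSpace ℝ (Fin d) → ℝ)
    (X : EuclideanSpace ℝ (Fin d)) : ℝ :=
  ∑ i : Fin d, ∑ j : Fin d, partialD i φ X * partialD j φ X * partialD i (partialD j φ) X

/-- `u` is a viscosity subsolution of `Δ_∞ u = 0` in the open set `Ω`: whenever a smooth `φ` touches
`u` from above at `Z ∈ Ω` (up to an additive constant, which does not change the derivatives
of `φ`), one has `Δ_∞ φ (Z) ≥ 0`. -/
def IsInfinitySubharmonicOn {d : ℕ} (u : EuclideanSpace ℝ (Fin d) → ℝ)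
    (Ω : Set (EuclideanSpace ℝ (Fin d))) : Prop :=
  ContinuousOn u Ω ∧ ∀ φ : EuclideanSpace ℝ (Fin d) → ℝ, ContDiff ℝ ∞ φ →
    ∀ Z ∈ Ω, IsLocalMax (fun X => u X - φ X) Z → 0 ≤ infinityLaplacian φ Z

/-- `u` is a viscosity supersolution of `Δ_∞ u = 0` in the open set `Ω`: whenever a smooth `φ`
touches `u` from below at `Y ∈ Ω` (up to an additive constant), one has `Δ_∞ φ (Y) ≤ 0`. -/
def IsInfinitySuperharmonicOn {d : ℕ} (u : EuclideanSpace ℝ (Fin d) → ℝ)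
    (Ω : Set (EuclideanSpace ℝ (Fin d))) : Prop :=
  ContinuousOn u Ω ∧ ∀ φ : EuclideanSpace ℝ (Fin d) → ℝ, ContDiff ℝ ∞ φ →
    ∀ Y ∈ Ω, IsLocalMin (fun X => u X - φ X) Y → infinityLaplacian φ Y ≤ 0

/-- Infinity-harmonic functions: viscosity solutions of `Δ_∞ u = 0` in the open set `Ω`. -/
def IsInfinityHarmonicOn {d : ℕ} (u : EuclideanSpace ℝ (Fin d) → ℝ)
    (Ω : Set (EuclideanSpace ℝ (Fin d))) : Prop :=
  IsInfinitySubharmonicOn u Ω ∧ IsInfinitySuperharmonicOn u Ω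

/-- `u ∈ C^{1,α}(Ω)` for an open set `Ω`: `u` is continuously differentiable in `Ω`, `u` and its
derivative are bounded in `Ω`, and the derivative is `α`-Hölder continuous in `Ω` with one constant
for the whole of `Ω` (that is, the `C^{1,α}(Ω)` norm is finite). -/
def IsC1HolderOn {d : ℕ} (α : ℝ≥0) (u : EuclideanSpace ℝ (Fin d) → ℝ)
    (Ω : Set (EuclideanSpace ℝ (Fin d))) : Prop :=
  ContDiffOn ℝ 1 u Ω ∧
    (∃ C : ℝ, ∀ X ∈ Ω, |u X| ≤ C ∧ ‖fderiv ℝ u X‖ ≤ C) ∧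
    ∃ C : ℝ≥0, HolderOnWith C α (fderiv ℝ u) Ω

/-! Quadratic polynomials touching the `σ i` from above add up to a test function for `u`, so `∑ p i
^ 2 * q i ≥ 0` for superjets taken at independently chosen coordinates in a box
(`IsInfinitySubharmonicOn.sum_superjet_nonneg`). Independence separates the sum: the infima `a i` of
`p ^ 2 * q` over superjets of `σ i` are finite and have nonnegative sum. The same holds for `-σ i`
with infima `b i` (`exists_superjetBound`). In one variable `a i + b i ≤ 0`
(`SuperjetBound.le_of_neg`), so all these sums vanish and each `σ i` is a viscosity solution of
`(σ')² σ'' = a i`. Such solutions are differentiable with `(σ')³` affine (`exists_cube_deriv`), and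
the cube root of an affine function is 1/3-Hölder. -/

/-! ### One-variable jets and comparison functions -/

/-- `(p, q)` is a second-order superjet of `f` at `x`: a quadratic polynomial with slope `p` and
second derivative `q` touches `f` from above at `x`. -/
def IsSuperjet (f : ℝ → ℝ) (x p q : ℝ) : Prop :=
  ∀ᶠ y in 𝓝 x, f y ≤ f x + p * (y - x) + q / 2 * (y - x) ^ 2

/-- `(f')² f'' ≥ l` in the viscosity sense on `s`. -/
def SuperjetBound (f : ℝ → ℝ) (l : ℝ) (s : Set ℝ) : Prop :=
  ∀ x ∈ s, ∀ p q : ℝ, IsSuperjet f x p q → l ≤ p ^ 2 * q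

theorem exists_orderIso_cube : ∃ e : ℝ ≃o ℝ, ∀ x, e x = x ^ 3 := by
  have hodd : Odd 3 := by decide
  have hs : Function.Surjective (fun x : ℝ => x ^ 3) :=
    (continuous_id.pow 3).surjective (Filter.tendsto_pow_atTop (by norm_num))
      ((Filter.tendsto_neg_atTop_atBot.comp ((Filter.tendsto_pow_atTop (n := 3) (by norm_num)).comp
        Filter.tendsto_neg_atBot_atTop)).congr fun x => by simp [hodd.neg_pow])
  exact ⟨StrictMono.orderIsoOfSurjective _ hodd.strictMono_pow hs, fun x => rfl⟩

theorem pow_three_lt_pow_three_iff {a b : ℝ} : a ^ 3 < b ^ 3 ↔ a < b :=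
  (show Odd 3 by decide).pow_lt_pow

/-- Explicit solutions `v` of `(v')² v'' = m`. -/
theorem exists_cubeRoot_antiderivative (m k : ℝ) : ∃ v w : ℝ → ℝ,
    (∀ x, HasDerivAt v (w x) x) ∧ (∀ x, w x ^ 3 = 3 * m * x + k) ∧
      ∀ x, w x ≠ 0 → HasDerivAt w (m / w x ^ 2) x := by
  obtain ⟨e, he⟩ := exists_orderIso_cube
  have hc : Continuous (fun x : ℝ => e.symm (3 * m * x + k)) := e.symm.continuous.comp (by fun_prop)
  have hcube (y : ℝ) : e.symm y ^ 3 = y := by rw [← he, e.apply_symm_apply]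
  refine ⟨fun y => ∫ x in (0 : ℝ)..y, e.symm (3 * m * x + k), fun x => e.symm (3 * m * x + k),
    fun x => (hc.integral_hasStrictDerivAt 0 x).hasDerivAt, fun x => hcube _, fun x hx => ?_⟩
  have h1 : HasDerivAt (fun y : ℝ => y ^ 3) (3 * e.symm (3 * m * x + k) ^ 2)
      (e.symm (3 * m * x + k)) := by
    simpa using hasDerivAt_pow 3 (e.symm (3 * m * x + k))
  have h2 := HasDerivAt.of_local_left_inverse e.symm.continuous.continuousAt h1
    (by positivity) (Filter.Eventually.of_forall hcube)
  have h3 : HasDerivAt (fun y : ℝ => 3 * m * y + k) (3 * m) x := by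
    simpa using ((hasDerivAt_id x).const_mul (3 * m)).add_const k
  refine (h2.comp x h3).congr_deriv ?_
  field_simp

/-- The gap `q' < q` absorbs the Taylor remainder: by the second derivative test, `v` minus the
parabola has a local maximum at `x`, which adds to that of `f - v`. -/
theorem IsSuperjet.of_isLocalMax_sub {f v w : ℝ → ℝ} {x q' q : ℝ}
    (hmax : IsLocalMax (fun y => f y - v y) x) (hv : ∀ y, HasDerivAt v (w y) y)
    (hw : HasDerivAt w q' x) (hq : q' < q) : IsSuperjet f x (w x) q := by
  let h : ℝ → ℝ := fun y => v y - (w x * (y - x) + q / 2 * (y - x) ^ 2)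
  have h1 (y : ℝ) : HasDerivAt h (w y - (w x + q * (y - x))) y := by
    have h2 : HasDerivAt (fun y => y - x) 1 y := (hasDerivAt_id y).sub_const x
    refine ((hv y).sub ((h2.const_mul (w x)).add ((h2.pow 2).const_mul (q / 2)))).congr_deriv ?_
    simp
    ring
  have hd : deriv h = fun y => w y - (w x + q * (y - x)) := funext fun y => (h1 y).deriv
  have hdd : deriv (deriv h) x = q' - q := by
    rw [hd]
    have h2 : HasDerivAt (fun y => y - x) 1 x := (hasDerivAt_id x).sub_const x
    refine HasDerivAt.deriv ((hw.sub ((h2.const_mul q).const_add (w x))).congr_deriv ?_)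
    ring
  have hloc : IsLocalMax h x := isLocalMax_of_deriv_deriv_neg (by rw [hdd]; linarith)
    (by rw [hd]; simp) (h1 x).continuousAt
  filter_upwards [hmax, hloc] with y hy1 hy2
  simp only [h, sub_self] at hy1 hy2
  linarith

theorem eventually_gt_of_hasDerivAt_pos {f : ℝ → ℝ} {f' x : ℝ} (hf : HasDerivAt f f' x)
    (h : 0 < f') : ∀ᶠ y in 𝓝[>] x, f x < f y := by
  have h1 := hasDerivWithinAt_iff_tendsto_slope' (by simp) |>.1 (hf.hasDerivWithinAt (s := Set.Ioi x))
  filter_upwards [h1.eventually_const_lt h, self_mem_nhdsWithin] with y hy hxy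
  rw [slope_def_field] at hy
  have hxy' : 0 < y - x := sub_pos.2 hxy
  have := (div_pos_iff_of_pos_right hxy').1 hy
  linarith

theorem eventually_gt_of_hasDerivAt_neg {f : ℝ → ℝ} {f' x : ℝ} (hf : HasDerivAt f f' x)
    (h : f' < 0) : ∀ᶠ y in 𝓝[<] x, f x < f y := by
  have h1 := hasDerivWithinAt_iff_tendsto_slope' (by simp) |>.1 (hf.hasDerivWithinAt (s := Set.Iio x))
  filter_upwards [h1.eventually_lt_const h, self_mem_nhdsWithin] with y hy hxy
  rw [slope_def_field] at hy
  have hxy' : y - x < 0 := sub_neg.2 hxy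
  have := pos_of_mul_neg_left (b := y - x) (a := f y - f x) (by
    have := mul_neg_of_neg_of_pos hy (sq_pos_of_neg hxy')
    have h2 : (f y - f x) / (y - x) * (y - x) ^ 2 = (f y - f x) * (y - x) := by
      field_simp [hxy'.ne]
    linarith) hxy'.le
  linarith

theorem exists_isLocalMax_of_hasDerivAt {f f' : ℝ → ℝ} {a b : ℝ} (hab : a < b)
    (hf : ∀ x ∈ Set.Icc a b, HasDerivAt f (f' x) x) (ha : 0 < f' a) (hb : f' b < 0) :
    ∃ x ∈ Set.Ioo a b, IsLocalMax f x := by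
  obtain ⟨c, hc, hmax⟩ := isCompact_Icc.exists_isMaxOn (Set.nonempty_Icc.2 hab.le)
    (fun x hx => (hf x hx).continuousAt.continuousWithinAt)
  have hac : a < c := by
    refine lt_of_le_of_ne hc.1 ?_
    rintro rfl
    obtain ⟨y, hy, hy'⟩ := ((eventually_gt_of_hasDerivAt_pos (hf a ⟨le_rfl, hab.le⟩) ha).and
      (Ioc_mem_nhdsGT hab)).exists
    exact (hmax (Set.Ioc_subset_Icc_self hy')).not_gt hy
  have hcb : c < b := by
    refine lt_of_le_of_ne hc.2 ?_
    rintro rfl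
    obtain ⟨y, hy, hy'⟩ := ((eventually_gt_of_hasDerivAt_neg (hf c ⟨hab.le, le_rfl⟩) hb).and
      (Ico_mem_nhdsLT hab)).exists
    exact (hmax (Set.Ico_subset_Icc_self hy')).not_gt hy
  exact ⟨c, ⟨hac, hcb⟩, hmax.isLocalMax (Icc_mem_nhds hac hcb)⟩

/-! ### The one-variable equation `(f')² f'' = l` -/

/-- Where `f` rises above a chord, a strictly concave parabola with nonzero slope touches it from
above, giving `p ^ 2 * q < 0`. -/
theorem SuperjetBound.convexOn {f : ℝ → ℝ} {l : ℝ} {s : Set ℝ} (hl : 0 ≤ l) (hs : Convex ℝ s)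
    (hf : ContinuousOn f s) (h : SuperjetBound f l s) : ConvexOn ℝ s f := by
  refine LinearOrder.convexOn_of_lt hs fun x hx y hy hxy a b ha hb hab => ?_
  by_contra! hcon
  simp only [smul_eq_mul] at hcon
  have hL : 0 < y - x := sub_pos.2 hxy
  have hsub : Set.Icc x y ⊆ s := hs.ordConnected.out hx hy
  have hzx : a * x + b * y - x = b * (y - x) := by linear_combination (x - 0) * hab
  have hb1 : b < 1 := by linarith
  obtain ⟨t, ht⟩ : ∃ t, t = (f y - f x) / (y - x) := ⟨_, rfl⟩
  have hty : t * (y - x) = f y - f x := by rw [ht]; field_simp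
  obtain ⟨D, hD⟩ : ∃ D, D = f (a * x + b * y) - (a * f x + b * f y) := ⟨_, rfl⟩
  have hDpos : 0 < D := by linarith
  have hfz : f (a * x + b * y) = f x + t * (b * (y - x)) + D := by
    linear_combination (1 : ℝ) * (-hD) + b * (-hty) + f x * hab
  -- The chord slope is tilted if it is zero, since a jet of zero slope gives no contradiction when
  -- `l = 0`.
  obtain ⟨r, hr0, hr⟩ : ∃ r : ℝ, r ≠ 0 ∧ |t - r| * (y - x) < D / 2 := by
    by_cases h0 : t = 0
    · refine ⟨D / 4 / (y - x), by positivity, ?_⟩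
      rw [h0, zero_sub, abs_neg, abs_of_pos (by positivity), div_mul_cancel₀ _ hL.ne']
      linarith
    · exact ⟨t, h0, by simpa using hDpos⟩
  -- The first bound keeps the maximum of `g` interior; the second keeps the touching slope nonzero
  -- throughout the interval.
  obtain ⟨ε, hε, hε1, hε2⟩ : ∃ ε : ℝ, 0 < ε ∧ ε * (y - x) ^ 2 < D / 2 ∧ 2 * ε * (y - x) < |r| := by
    have hr' : 0 < |r| := abs_pos.2 hr0
    refine ⟨min (D / 4 / (y - x) ^ 2) (|r| / 4 / (y - x)), by positivity, ?_, ?_⟩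
    · calc _ ≤ D / 4 / (y - x) ^ 2 * (y - x) ^ 2 := by gcongr; exact min_le_left _ _
        _ = D / 4 := by field_simp
        _ < _ := by linarith
    · calc _ ≤ 2 * (|r| / 4 / (y - x)) * (y - x) := by gcongr; exact min_le_right _ _
        _ = |r| / 2 := by field_simp; norm_num
        _ < _ := by linarith
  let g : ℝ → ℝ := fun w => f w - (r * (w - x) - ε * (w - x) ^ 2)
  have hg : ContinuousOn g (Set.Icc x y) := (hf.mono hsub).sub (by fun_prop)
  obtain ⟨c, hc, hmax⟩ := isCompact_Icc.exists_isMaxOn (Set.nonempty_Icc.2 hxy.le) hg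
  have hz : a * x + b * y ∈ Set.Icc x y := by
    constructor <;> nlinarith
  have hzc : g (a * x + b * y) ≤ g c := hmax hz
  have habs := abs_le.1 (le_refl |t - r|)
  have hgz : g (a * x + b * y) = f x + (t - r) * (b * (y - x)) + D + ε * (b * (y - x)) ^ 2 := by
    simp only [g, hzx, hfz]; ring
  have hgx : g x = f x := by simp [g]
  have hgy : g y = f x + (t - r) * (y - x) + ε * (y - x) ^ 2 := by
    simp only [g]; linear_combination -hty
  have hp := abs_nonneg (t - r)
  have hxc : x < c := by
    refine lt_of_le_of_ne hc.1 ?_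
    rintro rfl
    rw [hgx, hgz] at hzc
    have h1 : -(|t - r| * (y - x)) ≤ (t - r) * (b * (y - x)) := by
      have : -|t - r| * (b * (y - x)) ≤ (t - r) * (b * (y - x)) := by gcongr; exact habs.1
      have : |t - r| * (b * (y - x)) ≤ |t - r| * (1 * (y - x)) := by gcongr
      linarith
    have : 0 ≤ ε * (b * (y - x)) ^ 2 := by positivity
    linarith
  have hcy : c < y := by
    refine lt_of_le_of_ne hc.2 ?_
    rintro rfl
    rw [hgy, hgz] at hzc
    have h1 : (t - r) * (a * (c - x)) ≤ |t - r| * (c - x) := by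
      have : (t - r) * (a * (c - x)) ≤ |t - r| * (a * (c - x)) := by gcongr; exact habs.2
      have : |t - r| * (a * (c - x)) ≤ |t - r| * (1 * (c - x)) := by gcongr; linarith
      linarith
    have h2 : (t - r) * (a * (c - x)) = (t - r) * (c - x) - (t - r) * (b * (c - x)) := by
      rw [eq_sub_of_add_eq hab]; ring
    have : 0 ≤ ε * (b * (c - x)) ^ 2 := by positivity
    linarith
  have hjet : IsSuperjet f c (r - 2 * ε * (c - x)) (-(2 * ε)) := by
    filter_upwards [Icc_mem_nhds hxc hcy] with w hw
    have := hmax hw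
    simp only [g, Set.mem_ofPred_eq] at this
    linear_combination this
  have hslope : r - 2 * ε * (c - x) ≠ 0 := by
    intro h0
    have h1 : 2 * ε * (c - x) < |r| := lt_of_le_of_lt (by gcongr) hε2
    rw [show r = 2 * ε * (c - x) by linarith, abs_of_pos (by have := sub_pos.2 hxc; positivity)] at h1
    exact lt_irrefl _ h1
  have := h c (hsub hc) _ _ hjet
  have : 0 < (r - 2 * ε * (c - x)) ^ 2 := by positivity
  nlinarith

/-- At a kink, any slope `p` strictly between the one-sided derivatives admits touching parabolas
from below with arbitrarily large `q`; taking `p ≠ 0` violates the bound. -/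
theorem ConvexOn.differentiableAt_of_superjetBound_neg {f : ℝ → ℝ} {l : ℝ} {s : Set ℝ}
    (hs : IsOpen s) (hf : ConvexOn ℝ s f) (h : SuperjetBound (fun x => -f x) l s) {x : ℝ}
    (hx : x ∈ s) : DifferentiableAt ℝ f x := by
  have hxi : x ∈ interior s := by rwa [hs.interior_eq]
  have hR := hf.hasDerivWithinAt_rightDeriv_of_mem_interior hxi
  have hL := hf.hasDerivWithinAt_leftDeriv_of_mem_interior hxi
  obtain ⟨R, hRdef⟩ : ∃ R, R = derivWithin f (Set.Ioi x) x := ⟨_, rfl⟩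
  obtain ⟨L, hLdef⟩ : ∃ L, L = derivWithin f (Set.Iio x) x := ⟨_, rfl⟩
  have hle := hf.leftDeriv_le_rightDeriv_of_mem_interior hxi
  rw [← hRdef] at hR hle
  rw [← hLdef] at hL hle
  rcases hle.eq_or_lt with heq | hlt
  · rw [heq, hasDerivWithinAt_Iio_iff_Iic] at hL
    have h1 := hL.union (hasDerivWithinAt_Ioi_iff_Ici.1 hR)
    rw [Set.Iic_union_Ici, hasDerivWithinAt_univ] at h1
    exact h1.differentiableAt
  exfalso
  obtain ⟨p, hp, hp0⟩ : ∃ p ∈ Set.Ioo L R, p ≠ 0 := by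
    have h1 : (Set.Ioo L R).Infinite := Set.Ioo_infinite hlt
    obtain ⟨p, hp, hp0⟩ := h1.exists_notMem_finset {0}
    exact ⟨p, hp, by simpa using hp0⟩
  have hpp : 0 < p ^ 2 := by positivity
  obtain ⟨q, hq0, hq⟩ : ∃ q : ℝ, 0 < q ∧ p ^ 2 * q > -l := by
    refine ⟨(|l| + 1) / p ^ 2, by positivity, ?_⟩
    rw [mul_div_cancel₀ _ hpp.ne']
    linarith [neg_abs_le l]
  have hjet : IsSuperjet (fun x => -f x) x (-p) (-q) := by
    have hnear : Set.Ioo (x - (p - L) / q) (x + (R - p) / q) ∈ 𝓝 x := by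
      have := sub_pos.2 hp.1
      have := sub_pos.2 hp.2
      exact Ioo_mem_nhds (sub_lt_self _ (by positivity)) (lt_add_of_pos_right _ (by positivity))
    filter_upwards [hs.mem_nhds hx, hnear] with y hy hyn
    rcases lt_trichotomy y x with hyx | rfl | hyx
    · have h1 := hf.slope_le_leftDeriv_of_mem_interior hy hxi hyx
      rw [← hLdef, slope_def_field, div_le_iff₀ (sub_pos.2 hyx)] at h1
      have h2 : q * (x - y) < p - L := by
        have := hyn.1
        rw [mul_comm, ← lt_div_iff₀ hq0]; linarith
      nlinarith [mul_lt_mul_of_pos_right h2 (sub_pos.2 hyx), sq_nonneg (x - y)]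
    · simp
    · have h1 := hf.rightDeriv_le_slope_of_mem_interior hxi hy hyx
      rw [← hRdef, slope_def_field, le_div_iff₀ (sub_pos.2 hyx)] at h1
      have h2 : q * (y - x) < R - p := by
        have := hyn.2
        rw [mul_comm, ← lt_div_iff₀ hq0]; linarith
      nlinarith [mul_lt_mul_of_pos_right h2 (sub_pos.2 hyx), sq_nonneg (x - y)]
  have := h x hx _ _ hjet
  nlinarith

/-- If `(f')² f'' ≥ l` then `(f')³ - 3 l x` is nondecreasing, provided `f'` has at most one zero. -/
theorem SuperjetBound.monotone_cube {f g : ℝ → ℝ} {l : ℝ} {s : Set ℝ} (hs : Convex ℝ s)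
    (h : SuperjetBound f l s) (hfg : ∀ x ∈ s, HasDerivAt f (g x) x)
    (hz : ∀ x ∈ s, ∀ y ∈ s, g x = 0 → g y = 0 → x = y) {a b : ℝ} (ha : a ∈ s) (hb : b ∈ s)
    (hab : a < b) : g a ^ 3 - 3 * l * a ≤ g b ^ 3 - 3 * l * b := by
  have hsub : Set.Icc a b ⊆ s := hs.ordConnected.out ha hb
  -- The slack `m < l` makes the contact with an explicit solution for `m` contradictory; `m → l` is
  -- taken at the end.
  have hstrict (m : ℝ) (hm : m < l) : g a ^ 3 - 3 * m * a ≤ g b ^ 3 - 3 * m * b := by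
    by_contra! hlt
    have hk (k : ℝ) (hk1 : g b ^ 3 - 3 * m * b < k) (hk2 : k < g a ^ 3 - 3 * m * a) :
        ∃ x ∈ s, g x = 0 ∧ 3 * m * x + k = 0 := by
      obtain ⟨v, w, hv, hw3, hw⟩ := exists_cubeRoot_antiderivative m k
      obtain ⟨x, hx, hmax⟩ := exists_isLocalMax_of_hasDerivAt (f := fun y => f y - v y)
        (f' := fun y => g y - w y) hab (fun y hy => (hfg y (hsub hy)).sub (hv y))
        (sub_pos.2 (pow_three_lt_pow_three_iff.1 (by rw [hw3]; linarith)))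
        (sub_neg.2 (pow_three_lt_pow_three_iff.1 (by rw [hw3]; linarith)))
      have hxs := hsub (Set.Ioo_subset_Icc_self hx)
      have hgw : g x = w x := sub_eq_zero.1 (hmax.hasDerivAt_eq_zero ((hfg x hxs).sub (hv x)))
      by_cases h0 : w x = 0
      · exact ⟨x, hxs, hgw.trans h0, by rw [← hw3, h0]; norm_num⟩
      exfalso
      have hpos : 0 < w x ^ 2 := by positivity
      have hq : m / w x ^ 2 < (m + l) / 2 / w x ^ 2 := by gcongr; linarith
      have := h x hxs _ _ (IsSuperjet.of_isLocalMax_sub hmax hv (hw x h0) hq)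
      rw [mul_div_cancel₀ _ hpos.ne'] at this
      linarith
    -- Contact at a point where the slope vanishes is not excluded for a single `k`. Two values of
    -- `k` would both produce the unique zero of `g`, but `3 * m * x + k = 0` determines `k`.
    obtain ⟨k₁, h1, h1'⟩ := exists_between hlt
    obtain ⟨k₂, h2, h2'⟩ := exists_between h1'
    obtain ⟨x, hx, hgx, hxk⟩ := hk k₁ h1 h1'
    obtain ⟨y, hy, hgy, hyk⟩ := hk k₂ (h1.trans h2) h2'
    rw [hz x hx y hy hgx hgy] at hxk
    linarith
  have hpos := sub_pos.2 hab
  have hle : l ≤ (g b ^ 3 - g a ^ 3) / (3 * (b - a)) := by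
    refine le_of_forall_lt_imp_le_of_dense fun m hm => ?_
    rw [le_div_iff₀ (by positivity)]
    linarith [hstrict m hm]
  rw [le_div_iff₀ (by positivity)] at hle
  linarith

/-- The bounds make `f` convex, then differentiable. If `l = 0`, it is also concave, so `f'` is
constant. If `l > 0`, two zeros of the monotone `f'` would bound a flat piece with jet `(0, 0)`;
hence there is at most one zero, and `SuperjetBound.monotone_cube` applies to `f` and `-f`. -/
theorem exists_cube_deriv_of_nonneg {f : ℝ → ℝ} {l : ℝ} {s : Set ℝ} (hl : 0 ≤ l) (hs : Convex ℝ s)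
    (ho : IsOpen s) (hf : ContinuousOn f s) (h1 : SuperjetBound f l s)
    (h2 : SuperjetBound (fun x => -f x) (-l) s) :
    ∃ c : ℝ, ∀ x ∈ s, HasDerivAt f (deriv f x) x ∧ deriv f x ^ 3 = 3 * l * x + c := by
  have hconv := h1.convexOn hl hs hf
  have hd (x : ℝ) (hx : x ∈ s) : HasDerivAt f (deriv f x) x :=
    (hconv.differentiableAt_of_superjetBound_neg ho h2 hx).hasDerivAt
  have hmono : MonotoneOn (deriv f) s := hconv.monotoneOn_deriv fun x hx => (hd x hx).differentiableAt
  suffices hcon : ∀ x ∈ s, ∀ y ∈ s, x < y → deriv f x ^ 3 - 3 * l * x = deriv f y ^ 3 - 3 * l * y by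
    rcases s.eq_empty_or_nonempty with rfl | ⟨x₀, hx₀⟩
    · exact ⟨0, by simp⟩
    refine ⟨deriv f x₀ ^ 3 - 3 * l * x₀, fun x hx => ⟨hd x hx, ?_⟩⟩
    rcases lt_trichotomy x x₀ with hlt | rfl | hlt
    · linarith [hcon x hx x₀ hx₀ hlt]
    · ring
    · linarith [hcon x₀ hx₀ x hx hlt]
  intro x hx y hy hxy
  rcases hl.eq_or_lt with rfl | hpos
  · have hconc : ConcaveOn ℝ s f := neg_convexOn_iff.1
      (SuperjetBound.convexOn (by simp) hs hf.neg h2)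
    have := hconc.antitoneOn_deriv (fun x hx => (hd x hx).differentiableAt)
    rw [le_antisymm (hmono hx hy hxy.le) (this hx hy hxy.le)]
    ring
  · have hlt (x : ℝ) (hx : x ∈ s) (y : ℝ) (hy : y ∈ s) (hx0 : deriv f x = 0) (hy0 : deriv f y = 0) :
        ¬ x < y := by
      intro hxy
      have hsub : Set.Icc x y ⊆ s := hs.ordConnected.out hx hy
      obtain ⟨m, hm⟩ := exists_between hxy
      have hzero (t : ℝ) (ht : t ∈ Set.Ioo x y) : deriv f t = 0 :=
        le_antisymm (hy0 ▸ hmono (hsub (Set.Ioo_subset_Icc_self ht)) hy ht.2.le)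
          (hx0 ▸ hmono hx (hsub (Set.Ioo_subset_Icc_self ht)) ht.1.le)
      have hjet : IsSuperjet f m 0 0 := by
        filter_upwards [Ioo_mem_nhds hm.1 hm.2] with t ht
        have := (convex_Ioo x y).is_const_of_fderivWithin_eq_zero (𝕜 := ℝ) (f := f)
          (fun z hz => (hd z (hsub (Set.Ioo_subset_Icc_self hz))).differentiableAt.differentiableWithinAt)
          (fun z hz => by
            rw [fderivWithin_of_isOpen isOpen_Ioo hz]
            ext
            simp [hzero z hz]) ht hm
        simp [this]
      have := h1 m (hsub (Set.Ioo_subset_Icc_self hm)) _ _ hjet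
      norm_num at this
      linarith
    have hz (x : ℝ) (hx : x ∈ s) (y : ℝ) (hy : y ∈ s) (hx0 : deriv f x = 0) (hy0 : deriv f y = 0) :
        x = y :=
      le_antisymm (not_lt.1 (hlt y hy x hx hy0 hx0)) (not_lt.1 (hlt x hx y hy hx0 hy0))
    refine le_antisymm (h1.monotone_cube hs hd hz hx hy hxy) ?_
    have := h2.monotone_cube (g := fun x => -deriv f x) hs (fun x hx => (hd x hx).neg)
      (fun x hx y hy hx0 hy0 => hz x hx y hy (neg_eq_zero.1 hx0) (neg_eq_zero.1 hy0)) hx hy hxy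
    linarith

theorem exists_cube_deriv {f : ℝ → ℝ} {l : ℝ} {s : Set ℝ} (hs : Convex ℝ s)
    (ho : IsOpen s) (hf : ContinuousOn f s) (h1 : SuperjetBound f l s)
    (h2 : SuperjetBound (fun x => -f x) (-l) s) :
    ∃ c : ℝ, ∀ x ∈ s, HasDerivAt f (deriv f x) x ∧ deriv f x ^ 3 = 3 * l * x + c := by
  rcases le_total 0 l with hl | hl
  · exact exists_cube_deriv_of_nonneg hl hs ho hf h1 h2
  · obtain ⟨c, hc⟩ := exists_cube_deriv_of_nonneg (neg_nonneg.2 hl) hs ho hf.neg h2 (by simpa using h1)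
    refine ⟨-c, fun x hx => ?_⟩
    have hd := (hc x hx).1.neg
    simp only [neg_neg] at hd
    have h3 := (hc x hx).2
    rw [← hd.deriv] at hd
    have h4 : deriv (-f) x = -deriv f x := (hd.neg).deriv
    rw [h4] at h3
    exact ⟨hd, by linarith⟩

/-- A superjet bound and a subjet bound are ordered. -/
theorem SuperjetBound.le_of_neg {f : ℝ → ℝ} {a b : ℝ} {s : Set ℝ} (hs : Convex ℝ s)
    (ho : IsOpen s) (hne : s.Nonempty) (hf : ContinuousOn f s) (h1 : SuperjetBound f a s)
    (h2 : SuperjetBound (fun x => -f x) (-b) s) : a ≤ b := by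
  by_contra! hlt
  -- If `b < a`, then `f` solves the equation for both constants, so `(f')³` would be affine with
  -- two different slopes.
  have key (l : ℝ) (hla : l ≤ a) (hlb : b ≤ l) :=
    exists_cube_deriv hs ho hf (l := l) (fun x hx p q hj => hla.trans (h1 x hx p q hj))
      (fun x hx p q hj => (neg_le_neg hlb).trans (h2 x hx p q hj))
  obtain ⟨c, hc⟩ := key a le_rfl hlt.le
  obtain ⟨c', hc'⟩ := key b hlt.le le_rfl
  obtain ⟨x, hx⟩ := hne
  obtain ⟨y, hxy, hy⟩ : ∃ y, x < y ∧ y ∈ s :=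
    (Filter.Eventually.and (self_mem_nhdsWithin : Set.Ioi x ∈ 𝓝[>] x)
      (nhdsWithin_le_nhds (ho.mem_nhds hx))).exists
  nlinarith [(hc x hx).2, (hc' x hx).2, (hc y hy).2, (hc' y hy).2]

/-- Subtracting a parabola that grows more than `f` can oscillate forces an interior maximum. This
makes the sets of values `p ^ 2 * q` nonempty. -/
theorem exists_isSuperjet {f : ℝ → ℝ} {r : ℝ} (hr : 0 < r)
    (hf : ContinuousOn f (Set.Ioo (-r) r)) :
    ∃ x ∈ Set.Ioo (-r) r, ∃ p q : ℝ, IsSuperjet f x p q := by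
  have hsub : Set.Icc (-(r / 2)) (r / 2) ⊆ Set.Ioo (-r) r := fun x hx =>
    ⟨by linarith [hx.1], by linarith [hx.2]⟩
  have hf' := hf.mono hsub
  obtain ⟨M, hM⟩ := isCompact_Icc.exists_bound_of_continuousOn hf'
  have h0 : (0 : ℝ) ∈ Set.Icc (-(r / 2)) (r / 2) := ⟨by linarith, by linarith⟩
  have hM0 : 0 ≤ M := (norm_nonneg _).trans (hM 0 h0)
  obtain ⟨C, hC⟩ : ∃ C : ℝ, C * (r / 2) ^ 2 = 2 * M + 1 :=
    ⟨(2 * M + 1) / (r / 2) ^ 2, by field_simp⟩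
  obtain ⟨c, hc, hmax⟩ := isCompact_Icc.exists_isMaxOn ⟨0, h0⟩
    (hf'.sub (g := fun x => C * x ^ 2) (by fun_prop))
  have hc0 := hmax h0
  simp only [Set.mem_ofPred_eq, Pi.sub_apply] at hc0
  have hb := abs_le.1 (hM 0 h0)
  have hbc := abs_le.1 (hM c hc)
  have hend : c ^ 2 ≠ (r / 2) ^ 2 := by
    intro h
    rw [h, hC] at hc0
    linarith [hb.1, hbc.2]
  have hlt : -(r / 2) < c := lt_of_le_of_ne hc.1 fun h => hend (by rw [← h]; ring)
  have hgt : c < r / 2 := lt_of_le_of_ne hc.2 fun h => hend (by rw [h])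
  refine ⟨c, hsub hc, 2 * C * c, 2 * C, ?_⟩
  filter_upwards [Icc_mem_nhds hlt hgt] with y hy
  have := hmax hy
  simp only [Set.mem_ofPred_eq, Pi.sub_apply] at this
  linear_combination this

/-! ### Test functions with separated variables -/

theorem hasFDerivAt_sum_coord {d : ℕ} {f : Fin d → ℝ → ℝ} {f' : Fin d → ℝ}
    {X : EuclideanSpace ℝ (Fin d)} (h : ∀ i, HasDerivAt (f i) (f' i) (X i)) :
    HasFDerivAt (fun Y : EuclideanSpace ℝ (Fin d) => ∑ i, f i (Y i))
      (∑ i, f' i • (EuclideanSpace.proj i : EuclideanSpace ℝ (Fin d) →L[ℝ] ℝ)) X :=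
  HasFDerivAt.fun_sum fun i _ => (h i).comp_hasFDerivAt (f := fun Y : EuclideanSpace ℝ (Fin d) => Y i) X
    (EuclideanSpace.proj i : EuclideanSpace ℝ (Fin d) →L[ℝ] ℝ).hasFDerivAt

theorem partialD_sum_coord {d : ℕ} {f : Fin d → ℝ → ℝ} {f' : Fin d → ℝ}
    {X : EuclideanSpace ℝ (Fin d)} (h : ∀ i, HasDerivAt (f i) (f' i) (X i)) (j : Fin d) :
    partialD j (fun Y => ∑ i, f i (Y i)) X = f' j := by
  rw [partialD, (hasFDerivAt_sum_coord h).fderiv]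
  simp

theorem infinityLaplacian_quadratic {d : ℕ} (Z : EuclideanSpace ℝ (Fin d)) (p q : Fin d → ℝ) :
    infinityLaplacian (fun Y => ∑ i, (p i * (Y i - Z i) + q i / 2 * (Y i - Z i) ^ 2)) Z =
      ∑ i, p i ^ 2 * q i := by
  have h2 (z y : ℝ) : HasDerivAt (fun y => y - z) 1 y := (hasDerivAt_id y).sub_const z
  have h1 (j : Fin d) : partialD j
      (fun Y => ∑ i, (p i * (Y i - Z i) + q i / 2 * (Y i - Z i) ^ 2)) =
        fun Y => p j + q j * (Y j - Z j) := by
    ext X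
    refine partialD_sum_coord (f := fun i y => p i * (y - Z i) + q i / 2 * (y - Z i) ^ 2)
      (f' := fun i => p i + q i * (X i - Z i)) (fun i => ?_) j
    refine (((h2 (Z i) (X i)).const_mul (p i)).add
      (((h2 (Z i) (X i)).pow 2).const_mul (q i / 2))).congr_deriv ?_
    simp
    ring
  have h3 (i j : Fin d) : partialD i (fun Y => p j + q j * (Y j - Z j)) Z =
      if i = j then q j else 0 := by
    have h4 : HasFDerivAt (fun Y : EuclideanSpace ℝ (Fin d) => p j + q j * (Y j - Z j))
        (q j • (EuclideanSpace.proj j : EuclideanSpace ℝ (Fin d) →L[ℝ] ℝ)) Z :=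
      (((h2 (Z j) (Z j)).const_mul (q j)).const_add (p j) |>.congr_deriv (mul_one _)).comp_hasFDerivAt
        (f := fun Y : EuclideanSpace ℝ (Fin d) => Y j) Z
        (EuclideanSpace.proj j : EuclideanSpace ℝ (Fin d) →L[ℝ] ℝ).hasFDerivAt
    rw [partialD, h4.fderiv]
    simp [eq_comm]
  simp only [infinityLaplacian, h1, h3]
  simp [pow_two]

theorem infinityLaplacian_neg {d : ℕ} (φ : EuclideanSpace ℝ (Fin d) → ℝ)
    (X : EuclideanSpace ℝ (Fin d)) :
    infinityLaplacian (fun Y => -φ Y) X = -infinityLaplacian φ X := by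
  have h (i : Fin d) (ψ : EuclideanSpace ℝ (Fin d) → ℝ) :
      partialD i (fun Y => -ψ Y) = fun Y => -partialD i ψ Y := by
    ext Y
    simp [partialD, fderiv_fun_neg]
  simp [infinityLaplacian, h]

theorem IsInfinitySuperharmonicOn.neg {d : ℕ} {u : EuclideanSpace ℝ (Fin d) → ℝ}
    {Ω : Set (EuclideanSpace ℝ (Fin d))} (hu : IsInfinitySuperharmonicOn u Ω) :
    IsInfinitySubharmonicOn (fun X => -u X) Ω := by
  refine ⟨hu.1.neg, fun φ hφ Z hZ hmax => ?_⟩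
  have := hu.2 (fun Y => -φ Y) hφ.neg Z hZ (by
    refine hmax.neg.congr (Filter.Eventually.of_forall fun Y => ?_)
    dsimp only
    ring)
  rw [infinityLaplacian_neg] at this
  linarith

theorem IsInfinitySubharmonicOn.sum_superjet_nonneg {d : ℕ} {u : EuclideanSpace ℝ (Fin d) → ℝ}
    {σ : Fin d → ℝ → ℝ} {Ω : Set (EuclideanSpace ℝ (Fin d))} (hu : IsInfinitySubharmonicOn u Ω)
    (hΩ : IsOpen Ω) (hsep : ∀ X ∈ Ω, u X = ∑ i, σ i (X i)) {Z : EuclideanSpace ℝ (Fin d)}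
    (hZ : Z ∈ Ω) {p q : Fin d → ℝ} (hj : ∀ i, IsSuperjet (σ i) (Z i) (p i) (q i)) :
    0 ≤ ∑ i, p i ^ 2 * q i := by
  rw [← infinityLaplacian_quadratic Z p q]
  refine hu.2 _ (by fun_prop) Z hZ ?_
  have hjets : ∀ᶠ X : EuclideanSpace ℝ (Fin d) in 𝓝 Z, ∀ i,
      σ i (X i) ≤ σ i (Z i) + p i * (X i - Z i) + q i / 2 * (X i - Z i) ^ 2 :=
    Filter.eventually_all.2 fun i =>
      ((EuclideanSpace.proj i : EuclideanSpace ℝ (Fin d) →L[ℝ] ℝ).continuous.tendsto Z).eventually (hj i)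
  filter_upwards [hΩ.mem_nhds hZ, hjets] with X hX hXj
  rw [hsep X hX, hsep Z hZ]
  have := Finset.sum_le_sum fun i (_ : i ∈ Finset.univ) => hXj i
  simp only [add_assoc, Finset.sum_add_distrib] at this ⊢
  simp
  linarith

/-! ### Separating the constants -/

/-- The `t i` vary independently: fixing all but one bounds that one below, and near-minimizers
chosen simultaneously give the sum. -/
theorem sum_sInf_nonneg {ι : Type*} [Fintype ι] {A : ι → Set ℝ} (hne : ∀ i, (A i).Nonempty)
    (h : ∀ t : ι → ℝ, (∀ i, t i ∈ A i) → 0 ≤ ∑ i, t i) :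
    (∀ i, BddBelow (A i)) ∧ 0 ≤ ∑ i, sInf (A i) := by
  classical
  choose t₀ ht₀ using hne
  refine ⟨fun i => ⟨-∑ j ∈ Finset.univ.erase i, t₀ j, fun t ht => ?_⟩, ?_⟩
  · have := h (Function.update t₀ i t) fun j => by
      rcases eq_or_ne j i with rfl | hji
      · simpa using ht
      · simpa [hji] using ht₀ j
    rw [← Finset.add_sum_erase _ _ (Finset.mem_univ i), Function.update_self,
      Finset.sum_congr rfl fun j hj => Function.update_of_ne (Finset.ne_of_mem_erase hj) _ _] at this
    linarith
  · refine le_of_forall_pos_le_add fun ε hε => ?_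
    have hε' : 0 < ε / (Fintype.card ι + 1) := by positivity
    choose t ht hlt using fun i => Real.lt_sInf_add_pos ⟨t₀ i, ht₀ i⟩ hε'
    calc 0 ≤ ∑ i, t i := h t ht
      _ ≤ ∑ i, (sInf (A i) + ε / (Fintype.card ι + 1)) :=
        Finset.sum_le_sum fun i _ => (hlt i).le
      _ = ∑ i, sInf (A i) + ε * (Fintype.card ι / (Fintype.card ι + 1)) := by
        rw [Finset.sum_add_distrib]; simp; ring
      _ ≤ ∑ i, sInf (A i) + ε := by
        gcongr
        exact mul_le_of_le_one_right hε.le (div_le_one_of_le₀ (by linarith) (by positivity))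

theorem exists_superjetBound {ι : Type*} [Fintype ι] {f : ι → ℝ → ℝ} {s : ι → Set ℝ}
    (hjet : ∀ i, ∃ x ∈ s i, ∃ p q : ℝ, IsSuperjet (f i) x p q)
    (h : ∀ x p q : ι → ℝ, (∀ i, x i ∈ s i) → (∀ i, IsSuperjet (f i) (x i) (p i) (q i)) →
      0 ≤ ∑ i, p i ^ 2 * q i) :
    ∃ a : ι → ℝ, 0 ≤ ∑ i, a i ∧ ∀ i, SuperjetBound (f i) (a i) (s i) := by
  let A (i : ι) : Set ℝ := {t | ∃ x ∈ s i, ∃ p q : ℝ, IsSuperjet (f i) x p q ∧ p ^ 2 * q = t}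
  have hA := sum_sInf_nonneg (A := A)
    (fun i => let ⟨x, hx, p, q, hj⟩ := hjet i; ⟨_, x, hx, p, q, hj, rfl⟩) (fun t ht => by
      choose x hx p q hj hpq using ht
      simpa only [hpq] using h x p q hx hj)
  exact ⟨fun i => sInf (A i), hA.2, fun i x hx p q hj => csInf_le (hA.1 i) ⟨x, hx, p, q, hj, rfl⟩⟩

theorem exists_cube_deriv_of_separated {d : ℕ} {u : EuclideanSpace ℝ (Fin d) → ℝ}
    {σ : Fin d → ℝ → ℝ} {Ω : Set (EuclideanSpace ℝ (Fin d))} (hΩ : IsOpen Ω)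
    (hu : IsInfinityHarmonicOn u Ω) (hsep : ∀ X ∈ Ω, u X = ∑ i, σ i (X i)) {r : Fin d → ℝ}
    (hr : ∀ i, 0 < r i) (hσ : ∀ i, ContinuousOn (σ i) (Set.Ioo (-r i) (r i)))
    (hbox : ∀ X : EuclideanSpace ℝ (Fin d), (∀ i, X i ∈ Set.Ioo (-r i) (r i)) → X ∈ Ω) (i : Fin d) :
    ∃ l c : ℝ, ∀ x ∈ Set.Ioo (-r i) (r i),
      HasDerivAt (σ i) (deriv (σ i) x) x ∧ deriv (σ i) x ^ 3 = 3 * l * x + c := by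
  obtain ⟨a, ha, haσ⟩ := exists_superjetBound (fun j => exists_isSuperjet (hr j) (hσ j))
    fun x p q hx hj => hu.1.sum_superjet_nonneg hΩ hsep (Z := WithLp.toLp 2 x) (hbox _ hx) hj
  obtain ⟨b, hb, hbσ⟩ := exists_superjetBound (f := fun j x => -σ j x)
    (fun j => exists_isSuperjet (hr j) (hσ j).neg)
    fun x p q hx hj => hu.2.neg.sum_superjet_nonneg (σ := fun j x => -σ j x) hΩ
      (fun X hX => by rw [hsep X hX, Finset.sum_neg_distrib]) (Z := WithLp.toLp 2 x) (hbox _ hx) hj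
  have hle (j : Fin d) : a j + b j ≤ 0 := by
    have := (haσ j).le_of_neg (b := -b j) (convex_Ioo _ _) isOpen_Ioo
      ⟨0, neg_lt_zero.2 (hr j), hr j⟩ (hσ j) (by simpa using hbσ j)
    linarith
  -- Nonpositive terms with nonnegative total must all vanish.
  have hzero : a i + b i = 0 := by
    refine (Finset.sum_eq_zero_iff_of_nonpos fun j _ => hle j).1 (le_antisymm
      (Finset.sum_nonpos fun j _ => hle j) ?_) i (Finset.mem_univ i)
    rw [Finset.sum_add_distrib]
    exact add_nonneg ha hb
  obtain ⟨c, hc⟩ := exists_cube_deriv (convex_Ioo _ _) isOpen_Ioo (hσ i) (haσ i)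
    (by rw [← eq_neg_of_add_eq_zero_right hzero]; exact hbσ i)
  exact ⟨a i, c, hc⟩

/-! ### From affine `(σ')³` to the Hölder estimate -/

theorem abs_sub_le_rpow_of_pow_three {a b t : ℝ} (h : |a ^ 3 - b ^ 3| ≤ t) :
    |a - b| ≤ (4 * t) ^ (1 / 3 : ℝ) := by
  have h1 : |a - b| ^ 3 ≤ 4 * t := by
    have hfac : a ^ 3 - b ^ 3 = (a - b) * (a ^ 2 + a * b + b ^ 2) := by ring
    have hpos : 0 ≤ a ^ 2 + a * b + b ^ 2 := by nlinarith [sq_nonneg (a + b), sq_nonneg a, sq_nonneg b]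
    rw [hfac, abs_mul, abs_of_nonneg hpos] at h
    -- The difference of the two sides is `3 * (a + b) ^ 2`.
    have h2 : |a - b| ^ 2 ≤ 4 * (a ^ 2 + a * b + b ^ 2) := by
      rw [sq_abs]; nlinarith [sq_nonneg (a + b)]
    calc |a - b| ^ 3 = |a - b| * |a - b| ^ 2 := by ring
      _ ≤ |a - b| * (4 * (a ^ 2 + a * b + b ^ 2)) := by gcongr
      _ ≤ 4 * t := by linarith
  calc |a - b| = (|a - b| ^ 3) ^ (1 / 3 : ℝ) := by
        rw [← Real.rpow_natCast, ← Real.rpow_mul (abs_nonneg _)]; norm_num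
    _ ≤ _ := by gcongr

theorem holderOnWith_of_norm_sub_le {E F : Type*} [SeminormedAddCommGroup E]
    [SeminormedAddCommGroup F] {f : E → F} {s : Set E} {C α : ℝ≥0}
    (h : ∀ x ∈ s, ∀ y ∈ s, ‖f x - f y‖ ≤ C * ‖x - y‖ ^ (α : ℝ)) : HolderOnWith C α f s := by
  intro x hx y hy
  rw [edist_dist, edist_dist, ENNReal.ofReal_rpow_of_nonneg dist_nonneg α.coe_nonneg,
    ← ENNReal.ofReal_coe_nnreal, ← ENNReal.ofReal_mul C.coe_nonneg]
  refine ENNReal.ofReal_le_ofReal ?_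
  rw [dist_eq_norm, dist_eq_norm]
  exact h x hx y hy

theorem isC1HolderOn_of_cube_deriv {d : ℕ} {u : EuclideanSpace ℝ (Fin d) → ℝ}
    {σ : Fin d → ℝ → ℝ} {r : ℝ} (hσ : ∀ i, ContinuousOn (σ i) (Set.Icc (-r) r))
    (hsep : ∀ X ∈ Metric.ball (0 : EuclideanSpace ℝ (Fin d)) r, u X = ∑ i, σ i (X i))
    {l c : Fin d → ℝ} (hd : ∀ i, ∀ x ∈ Set.Ioo (-r) r,
      HasDerivAt (σ i) (deriv (σ i) x) x ∧ deriv (σ i) x ^ 3 = 3 * l i * x + c i) :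
    IsC1HolderOn (1 / 3) u (Metric.ball 0 r) := by
  have hcoord (X : EuclideanSpace ℝ (Fin d)) (hX : X ∈ Metric.ball 0 r) (i : Fin d) :
      X i ∈ Set.Ioo (-r) r := by
    rw [mem_ball_zero_iff] at hX
    exact abs_lt.1 ((PiLp.norm_apply_le X i).trans_lt hX)
  let P (i : Fin d) : EuclideanSpace ℝ (Fin d) →L[ℝ] ℝ := EuclideanSpace.proj i
  have hfd (X : EuclideanSpace ℝ (Fin d)) (hX : X ∈ Metric.ball 0 r) :
      HasFDerivAt u (∑ i, deriv (σ i) (X i) • P i) X :=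
    (hasFDerivAt_sum_coord fun i => (hd i _ (hcoord X hX i)).1).congr_of_eventuallyEq
      (Filter.eventually_of_mem (Metric.isOpen_ball.mem_nhds hX) hsep)
  -- Here `12 = 4 * 3`: the 4 from `abs_sub_le_rpow_of_pow_three`, the 3 from the slope `3 * l i`.
  have hholder : HolderOnWith (∑ i, (12 * ‖l i‖₊) ^ (1 / 3 : ℝ) * ‖P i‖₊) (1 / 3) (fderiv ℝ u)
      (Metric.ball 0 r) := by
    refine holderOnWith_of_norm_sub_le fun X hX Y hY => ?_
    rw [(hfd X hX).fderiv, (hfd Y hY).fderiv, ← Finset.sum_sub_distrib]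
    push_cast
    rw [Finset.sum_mul]
    refine norm_sum_le_of_le _ fun i _ => ?_
    rw [← sub_smul, norm_smul, mul_right_comm]
    gcongr
    rw [← Real.mul_rpow (by positivity) (norm_nonneg _)]
    have hle : |deriv (σ i) (X i) ^ 3 - deriv (σ i) (Y i) ^ 3| ≤ 3 * ‖l i‖ * ‖X - Y‖ := by
      rw [(hd i _ (hcoord X hX i)).2, (hd i _ (hcoord Y hY i)).2]
      calc |3 * l i * X i + c i - (3 * l i * Y i + c i)| = 3 * ‖l i‖ * ‖(X - Y) i‖ := by
            rw [Real.norm_eq_abs, Real.norm_eq_abs, ← abs_of_pos (show (0 : ℝ) < 3 by norm_num),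
              ← abs_mul, ← abs_mul, abs_of_pos (show (0 : ℝ) < 3 by norm_num), PiLp.sub_apply]
            ring_nf
        _ ≤ _ := by gcongr; exact PiLp.norm_apply_le _ i
    refine (abs_sub_le_rpow_of_pow_three hle).trans_eq ?_
    ring_nf
  refine ⟨?_, ?_, _, hholder⟩
  · rw [← zero_add 1, contDiffOn_succ_iff_fderiv_of_isOpen Metric.isOpen_ball]
    exact ⟨fun X hX => (hfd X hX).differentiableAt.differentiableWithinAt, by simp,
      contDiffOn_zero.2 (hholder.continuousOn (by norm_num))⟩
  · choose M hM using fun i => isCompact_Icc.exists_bound_of_continuousOn (hσ i)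
    -- The `+ 1` lets `|σ'|` be bounded by its cube: if `|σ'|` exceeded the bound it would be at
    -- least 1, hence at most `|σ'| ^ 3`.
    refine ⟨max (∑ i, M i) (∑ i, (3 * |l i| * r + |c i| + 1) * ‖P i‖), fun X hX => ⟨?_, ?_⟩⟩
    · refine le_max_of_le_left ?_
      rw [hsep X hX]
      exact norm_sum_le_of_le _ fun i _ => hM i _ (Set.Ioo_subset_Icc_self (hcoord X hX i))
    · refine le_max_of_le_right ?_
      rw [(hfd X hX).fderiv]
      refine norm_sum_le_of_le _ fun i _ => ?_
      rw [norm_smul]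
      gcongr
      have hx := hcoord X hX i
      have h3 : |deriv (σ i) (X i)| ^ 3 ≤ 3 * |l i| * r + |c i| := by
        rw [← abs_pow, (hd i _ hx).2]
        refine (abs_add_le _ _).trans ?_
        rw [abs_mul, abs_mul, abs_of_pos (show (0 : ℝ) < 3 by norm_num)]
        gcongr
        exact (abs_lt.2 hx).le
      rw [Real.norm_eq_abs]
      by_contra! hlt
      have h1 : 1 ≤ |deriv (σ i) (X i)| := by
        have : 0 ≤ |deriv (σ i) (X i)| ^ 3 := by positivity
        linarith
      linarith [le_self_pow₀ h1 (show 3 ≠ 0 by norm_num)]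

/-! ### Boxes in the unit ball and conclusion -/

/-- The box is long only in direction `i`: the squares sum to at most `1/4 + 1/4`, whereas the cube
of half-side `1/2` leaves the unit ball in high dimension. -/
theorem mem_ball_of_coord_mem_Ioo {d : ℕ} (i : Fin d) {X : EuclideanSpace ℝ (Fin d)}
    (hX : ∀ j, |X j| < (if j = i then 1 / 2 else 1 / (2 * d) : ℝ)) : X ∈ Metric.ball 0 1 := by
  have hd : (0 : ℝ) < d := by exact_mod_cast i.pos
  have hd1 : (1 : ℝ) ≤ d := by exact_mod_cast i.pos
  rw [mem_ball_zero_iff, ← sq_lt_one_iff₀ (norm_nonneg _), EuclideanSpace.norm_sq_eq]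
  have hi := hX i
  rw [if_pos rfl] at hi
  have hrest : ∑ j ∈ Finset.univ.erase i, ‖X j‖ ^ 2 ≤
      ∑ j ∈ Finset.univ.erase i, (1 / (2 * d) : ℝ) ^ 2 := by
    refine Finset.sum_le_sum fun j hj => ?_
    have := hX j
    rw [if_neg (Finset.ne_of_mem_erase hj)] at this
    exact pow_le_pow_left₀ (norm_nonneg _) this.le 2
  have hcount : ∑ j ∈ Finset.univ.erase i, (1 / (2 * d) : ℝ) ^ 2 ≤ 1 / 4 := by
    calc _ ≤ ∑ j : Fin d, (1 / (2 * d) : ℝ) ^ 2 :=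
          Finset.sum_le_sum_of_subset_of_nonneg (Finset.erase_subset _ _) fun _ _ _ => by positivity
      _ = 1 / 4 * (1 / d) := by simp; field_simp; norm_num
      _ ≤ 1 / 4 * 1 := by gcongr; exact (div_le_one hd).2 hd1
      _ = _ := by norm_num
  rw [← Finset.add_sum_erase _ _ (Finset.mem_univ i)]
  have : ‖X i‖ ^ 2 ≤ (1 / 2) ^ 2 := pow_le_pow_left₀ (norm_nonneg _) hi.le 2
  linarith

theorem proposition4p2 (d : ℕ) (u : EuclideanSpace ℝ (Fin d) → ℝ) (σ : Fin d → ℝ → ℝ)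
    (hu : IsInfinityHarmonicOn u (Metric.ball 0 1))
    (hσ : ∀ i : Fin d, ContinuousOn (σ i) (Set.Ioo (-1) 1))
    (hsep : ∀ X ∈ Metric.ball (0 : EuclideanSpace ℝ (Fin d)) 1, u X = ∑ i : Fin d, σ i (X i)) :
    IsC1HolderOn (1 / 3) u (Metric.ball 0 (1 / 2)) := by
  -- Each coordinate uses its own box, so the one-variable result covers the full range of that
  -- coordinate on the half ball.
  have hcube (i : Fin d) : ∃ l c : ℝ, ∀ x ∈ Set.Ioo (-(1 / 2) : ℝ) (1 / 2),
      HasDerivAt (σ i) (deriv (σ i) x) x ∧ deriv (σ i) x ^ 3 = 3 * l * x + c := by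
    have hd : (0 : ℝ) < d := by exact_mod_cast i.pos
    have hd1 : (1 : ℝ) ≤ d := by exact_mod_cast i.pos
    have hr (j : Fin d) : 0 < (if j = i then 1 / 2 else 1 / (2 * d) : ℝ) := by
      split_ifs <;> positivity
    have hr1 (j : Fin d) : (if j = i then 1 / 2 else 1 / (2 * d) : ℝ) ≤ 1 := by
      split_ifs
      · norm_num
      · rw [div_le_one (by positivity)]; linarith
    have := exists_cube_deriv_of_separated Metric.isOpen_ball hu hsep hr
      (fun j => (hσ j).mono (Set.Ioo_subset_Ioo (neg_le_neg (hr1 j)) (hr1 j)))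
      (fun X hX => mem_ball_of_coord_mem_Ioo i fun j => abs_lt.2 (hX j)) i
    simpa only [if_true] using this
  choose l c hlc using hcube
  exact isC1HolderOn_of_cube_deriv
    (fun i => (hσ i).mono (Set.Icc_subset_Ioo (by norm_num) (by norm_num)))
    (fun X hX => hsep X (Metric.ball_subset_ball (by norm_num) hX)) hlc
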